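/- Let $n\ge 1$. A signed digraph on the nodes $v_1,\dots,v_n$ consists of an edge set and a real weighted adjacency matrix $\mathcal A=[a_{ij}]\in\mathbb R^{n\times n}$ with $a_{ii}=0$ for all $i$, where $a_{ij}\neq 0$ if and only if $(v_j,v_i)$ is an edge (directed from $v_j$ to $v_i$). Its Laplacian $L=[l_{ij}]$ is given by $l_{ii}=\sum_{k}|a_{ik}|$ (the sum over all $k$ such that $(v_k,v_i)$ is an edge) and $l_{ij}=-a_{ij}$ for $j\ne i$. Write $|\mathcal A|=[|a_{ij}|]$, and for a nonnegative matrix $A=[a_{ij}]$ let $\mathcal L_A$ be the matrix with diagonal entries $\sum_{k\neq i}a_{ik}$ and off-diagonal entries $-a_{ij}$. Let $\mathcal D_n$ be the set of diagonal matrices with all diagonal entries in $\{1,-1\}$. Let $t_0\ge 0$, and let $\mathcal G(t)$, $t\ge t_0$, be a time-varying signed digraph with adjacency matrix $\mathcal A(t)$ and Laplacian $L(t)$ that switches among finitely many signed digraphs $\mathcal G_{\sigma_1},\dots,\mathcal G_{\sigma_M}$ on the same $n$ nodes: there are $\tau>0$ and times $t_0<t_1<t_2<\cdots$ with $t_{k+1}-t_k\ge\tau$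 for all $k\ge 0$ such that on each interval $[t_k,t_{k+1})$, $\mathcal G(t)$ is constantly equal to one of $\mathcal G_{\sigma_1},\dots,\mathcal G_{\sigma_M}$. Assume that: (i) there is a constant $T>0$ such that for every $p\in\{1,\dots,M\}$ and every $\hat t\ge t_0$ there is some $t\in[\hat t,\hat t+T]$ with $\mathcal G(t)=\mathcal G_{\sigma_p}$; (ii) the union $\bigcup_{p=1}^M\mathcal G_{\sigma_p}$ (the digraph whose edge set is the union of the edge sets) is strongly connected; (iii) $\mathcal G(t)$ is simultaneously structurally balanced, that is, there is a constant matrix $D\in\mathcal D_n$ with $D\mathcal A(t)D=|\mathcal A(t)|$ for all $t\ge t_0$. For a piecewise constant, right-continuous $A(t)$, let $\Phi_A(t,t_0)$, $t\ge t_0$, be the state transition matrix of $\dot\xi(t)=A(t)\xi(t)$, that is, the continuous solution of $\dot\Phi=A(t)\Phi$ (derivatives from the right) with $\Phi(t_0,t_0)=I$. Then there is a vector $\nu(t_0)\in\mathbb R^n$ with nonnegative entries and $\nu(t_0)^{\mathsf T}1_n=1$ such that $$\lim_{t\to\infty}\Phi_{-\mathcal L_{|\mathcal A(t)|}}(t,t_0)=1_n\nu(t_0)^{\mathsf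 T}\quad\text{exponentially fast},$$ and, for every $D\in\mathcal D_n$ with $D\mathcal A(t)D=|\mathcal A(t)|$ for all $t\ge t_0$, $$\lim_{t\to\infty}\Phi_{-L(t)}(t,t_0)=D1_n\nu(t_0)^{\mathsf T}D\quad\text{exponentially fast}.$$ Here $F(t)\to F_\infty$ exponentially fast means that there are constants $C,r>0$ with $|F(t)_{ij}-(F_\infty)_{ij}|\le Ce^{-r(t-t_0)}$ for all $t\ge t_0$ and all $i,j$. -/

import Mathlib

open Set Filter Topology

namespace OpinionDynamics

/-! ### Signed digraphs -/

/-- A signed digraph on the nodes `v_i`, `i : Fin n`: an edge set together with a real weighted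
adjacency matrix `[a_ij]` without self-loops, where `a_ij ≠ 0` exactly if there is an edge from
`v_j` to `v_i`. -/
structure SignedDigraph (n : ℕ) where
  /-- the directed edges; `(j, i)` is an edge from `v_j` to `v_i` -/
  edges : Set (Fin n × Fin n)
  /-- the weighted adjacency matrix -/
  adj : Matrix (Fin n) (Fin n) ℝ
  adj_ne_zero_iff : ∀ i j, adj i j ≠ 0 ↔ (j, i) ∈ edges
  adj_self : ∀ i, adj i i = 0

/-- An edge set on `Fin n` is strongly connected if there is a directed path between each ordered
pair of distinct nodes. -/
def StronglyConnected {n : ℕ} (E : Set (Fin n × Fin n)) : Prop :=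
  ∀ i j : Fin n, i ≠ j → Relation.TransGen (fun a b => (a, b) ∈ E) i j

/-- The edge set of the union of a family of signed digraphs on the same nodes. -/
def unionEdges {n M : ℕ} (Gσ : Fin M → SignedDigraph n) : Set (Fin n × Fin n) :=
  ⋃ p, (Gσ p).edges

/-- The entrywise absolute value `|A| = [|a_ij|]`. -/
def absMatrix {n : ℕ} (A : Matrix (Fin n) (Fin n) ℝ) : Matrix (Fin n) (Fin n) ℝ :=
  Matrix.of fun i j => |A i j|

/-- The Laplacian of a nonnegative matrix `A`:
`l_ii = ∑_{k ≠ i} a_ik` and `l_ij = -a_ij` for `j ≠ i`. -/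
def nonnegLaplacian {n : ℕ} (A : Matrix (Fin n) (Fin n) ℝ) : Matrix (Fin n) (Fin n) ℝ :=
  Matrix.of fun i j => if j = i then ∑ k ∈ Finset.univ.erase i, A i k else -A i j

open scoped Classical in
/-- The Laplacian of a signed digraph: `l_ii = ∑_{k ∈ N_i} |a_ik|`, where `N_i` is the set of
(labels of) neighbors of `v_i`, and `l_ij = -a_ij` for `j ≠ i`. -/
noncomputable def SignedDigraph.laplacian {n : ℕ} (G : SignedDigraph n) :
    Matrix (Fin n) (Fin n) ℝ :=
  Matrix.of fun i j =>
    if j = i then ∑ k ∈ Finset.univ.filter (fun k => (k, i) ∈ G.edges), |G.adj i k|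
    else -G.adj i j

/-! ### Switching signed digraphs -/

/-- From time `t₀` on, the time-varying signed digraph `G` switches among the finitely many signed
digraphs `Gσ p`, at times `t₀ = t 0 < t 1 < ⋯` with a positive dwell time `τ`:
`G` is constantly equal to a member `Gk k` of the family on `[t k, t (k+1))`. -/
def IsSwitching {n M : ℕ} (Gσ : Fin M → SignedDigraph n) (G : ℝ → SignedDigraph n) (t₀ : ℝ) :
    Prop :=
  ∃ τ : ℝ, 0 < τ ∧ ∃ t : ℕ → ℝ, t 0 = t₀ ∧ (∀ k, τ ≤ t (k + 1) - t k) ∧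
    ∃ Gk : ℕ → SignedDigraph n, (∀ k, ∃ p, Gk k = Gσ p) ∧
      ∀ k, ∀ s ∈ Ico (t k) (t (k + 1)), G s = Gk k

/-- Recurrence: for a constant `T > 0`, each member of the family is active at some instant of each
time interval `[t', t' + T]` with `t' ≥ t₀`. -/
def IsRecurrent {n M : ℕ} (Gσ : Fin M → SignedDigraph n) (G : ℝ → SignedDigraph n) (t₀ : ℝ) :
    Prop :=
  ∃ T : ℝ, 0 < T ∧ ∀ p : Fin M, ∀ t' : ℝ, t₀ ≤ t' → ∃ s ∈ Icc t' (t' + T), G s = Gσ p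

/-- `D = diag(d_1, …, d_n)` with all `d_i ∈ {1, -1}`. -/
def IsSignMatrix {n : ℕ} (D : Matrix (Fin n) (Fin n) ℝ) : Prop :=
  ∃ d : Fin n → ℝ, (∀ i, d i = 1 ∨ d i = -1) ∧ D = Matrix.diagonal d

/-- `D` is a gauge for `G` from time `t₀` on: a constant diagonal sign matrix with
`D A(t) D = |A(t)|` for all `t ≥ t₀`. -/
def IsGauge {n : ℕ} (G : ℝ → SignedDigraph n) (t₀ : ℝ) (D : Matrix (Fin n) (Fin n) ℝ) : Prop :=
  IsSignMatrix D ∧ ∀ t, t₀ ≤ t → D * (G t).adj * D = absMatrix (G t).adj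

/-- Simultaneous structural balance of `G(t)`, `t ≥ t₀`. -/
def IsSimultaneouslyBalanced {n : ℕ} (G : ℝ → SignedDigraph n) (t₀ : ℝ) : Prop :=
  ∃ D, IsGauge G t₀ D

/-! ### State transition matrices -/

/-- `Φ` solves `Φ' = A(t) Φ`, `Φ(t₀) = I` on `[t₀, ∞)`: it is continuous there, and at every
`t ≥ t₀` its derivative from the right is `A(t) Φ(t)`. (A solution for a coefficient that jumps at
switching times has no two-sided derivative there; for a piecewise constant, right-continuous
coefficient this is the usual notion of solution.) -/
def IsStateTransition {n : ℕ} (A : ℝ → Matrix (Fin n) (Fin n) ℝ) (t₀ : ℝ)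
    (Φ : ℝ → Matrix (Fin n) (Fin n) ℝ) : Prop :=
  Φ t₀ = 1 ∧ (∀ i j, ContinuousOn (fun s => Φ s i j) (Ici t₀)) ∧
    ∀ t, t₀ ≤ t → ∀ i j, HasDerivWithinAt (fun s => Φ s i j) ((A t * Φ t) i j) (Ici t) t

/-- The state transition matrix `Φ_A(t, t₀)` of the linear system `ξ' = A(t) ξ`. For the
coefficients used here it exists and is unique on `[t₀, ∞)`, as proved below. -/
noncomputable def stateTransition {n : ℕ} (A : ℝ → Matrix (Fin n) (Fin n) ℝ) (t t₀ : ℝ) :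
    Matrix (Fin n) (Fin n) ℝ :=
  Classical.epsilon (IsStateTransition A t₀) t

/-- `F(t)` converges to `L` exponentially fast as `t → ∞`. -/
def ConvergesExponentially {n : ℕ} (F : ℝ → Matrix (Fin n) (Fin n) ℝ) (t₀ : ℝ)
    (L : Matrix (Fin n) (Fin n) ℝ) : Prop :=
  Tendsto F atTop (𝓝 L) ∧
    ∃ C : ℝ, 0 < C ∧ ∃ r : ℝ, 0 < r ∧
      ∀ t, t₀ ≤ t → ∀ i j, |F t i j - L i j| ≤ C * Real.exp (-r * (t - t₀))

/-! ### Existence and uniqueness of the state transition matrix -/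

section Existence

attribute [local instance] Matrix.linftyOpNormedRing Matrix.linftyOpNormedAlgebra

/-- Partial products of the fundamental solution for a piecewise constant coefficient. -/
noncomputable def partialFlow {n : ℕ} (t : ℕ → ℝ) (B : ℕ → Matrix (Fin n) (Fin n) ℝ) :
    ℕ → ℝ → Matrix (Fin n) (Fin n) ℝ
  | 0, _ => 1
  | k + 1, s => NormedSpace.exp ((min s (t (k + 1)) - min s (t k)) • B k) * partialFlow t B k s

theorem exists_isStateTransition {n : ℕ} {A : ℝ → Matrix (Fin n) (Fin n) ℝ} {t₀ τ : ℝ}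
    (hτ : 0 < τ) {t : ℕ → ℝ} (ht0 : t 0 = t₀) (ht : ∀ k, τ ≤ t (k + 1) - t k)
    {B : ℕ → Matrix (Fin n) (Fin n) ℝ}
    (hB : ∀ k, ∀ s ∈ Ico (t k) (t (k + 1)), A s = B k) :
    ∃ Φ, IsStateTransition A t₀ Φ := by
  have hmono : Monotone t := monotone_nat_of_le_succ fun k => by linarith [ht k]
  have hgrow : ∀ k : ℕ, t₀ + k * τ ≤ t k := by
    intro k
    induction k with
    | zero => simp [ht0]
    | succ k ih => push_cast; linarith [ht k]
  have hunb : ∀ s : ℝ, ∃ k, s < t k := by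
    intro s
    obtain ⟨k, hk⟩ := exists_nat_gt ((s - t₀) / τ)
    refine ⟨k, lt_of_lt_of_le ?_ (hgrow k)⟩
    rw [div_lt_iff₀ hτ] at hk
    linarith
  have hcont : ∀ k, Continuous (partialFlow t B k) := by
    intro k
    induction k with
    | zero => exact continuous_const
    | succ k ih =>
      refine Continuous.mul (NormedSpace.exp_continuous.comp ?_) ih
      fun_prop
  have hstab : ∀ k m, k ≤ m → ∀ s, s ≤ t k → partialFlow t B m s = partialFlow t B k s := by
    intro k m hkm s hs
    induction m, hkm using Nat.le_induction with
    | base => rfl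
    | succ m hkm ih =>
      have h1 : s ≤ t m := hs.trans (hmono hkm)
      have h2 : s ≤ t (m + 1) := hs.trans (hmono (by omega))
      simp only [partialFlow, min_eq_left h1, min_eq_left h2, sub_self, zero_smul,
        NormedSpace.exp_zero, one_mul, ih]
  have hconst : ∀ k s, t k ≤ s → partialFlow t B k s = partialFlow t B k (t k) := by
    intro k
    induction k with
    | zero => intro s _; rfl
    | succ k ih =>
      intro s hs
      have h1 : t k ≤ t (k + 1) := hmono (by omega)
      simp only [partialFlow, min_eq_right hs, min_eq_right (h1.trans hs), min_self,
        min_eq_right h1, ih s (h1.trans hs), ih (t (k + 1)) h1]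
  choose N hN using hunb
  have hΦ : ∀ k s, s ≤ t k → partialFlow t B (N s) s = partialFlow t B k s := by
    intro k s hs
    rcases le_total k (N s) with h | h
    · exact hstab k (N s) h s hs
    · exact (hstab (N s) k h s (hN s).le).symm
  refine ⟨fun s => partialFlow t B (N s) s, ?_, ?_, ?_⟩
  · exact hΦ 0 t₀ ht0.ge
  · intro i j s _
    have hev : (fun x => partialFlow t B (N x) x i j) =ᶠ[𝓝 s]
        fun x => partialFlow t B (N s) x i j := by
      filter_upwards [Iio_mem_nhds (hN s)] with x hx
      rw [hΦ (N s) x (le_of_lt hx)]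
    have hc : Continuous fun x => partialFlow t B (N s) x i j :=
      (continuous_apply_apply i j).comp (hcont (N s))
    exact (hc.continuousAt.congr hev.symm).continuousWithinAt
  · intro s hs i j
    obtain ⟨k, hk1, hk2⟩ : ∃ k, t k ≤ s ∧ s < t (k + 1) := by
      classical
      have hex : ∃ m, s < t m := ⟨N s, hN s⟩
      have h0 : Nat.find hex ≠ 0 := by
        intro h
        have := Nat.find_spec hex
        rw [h, ht0] at this
        linarith
      obtain ⟨k, hk⟩ := Nat.exists_eq_succ_of_ne_zero h0
      refine ⟨k, ?_, ?_⟩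
      · exact not_lt.mp (Nat.find_min hex (by omega))
      · have := Nat.find_spec hex
        rwa [hk] at this
    set Y := partialFlow t B k (t k) with hY
    have hform : ∀ x ∈ Ico s (t (k + 1)), partialFlow t B (N x) x =
        NormedSpace.exp ((x - t k) • B k) * Y := by
      intro x hx
      rw [hΦ (k + 1) x hx.2.le]
      simp only [partialFlow, min_eq_left hx.2.le, min_eq_right (hk1.trans hx.1),
        hconst k x (hk1.trans hx.1), hY]
    have hd : HasDerivAt (fun x : ℝ => NormedSpace.exp ((x - t k) • B k) * Y)
        (B k * (NormedSpace.exp ((s - t k) • B k) * Y)) s := by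
      have h1 := (hasDerivAt_exp_smul_const' (𝕂 := ℝ) (B k) (s - t k)).comp_sub_const s (t k)
      have h2 := h1.mul_const Y
      rwa [mul_assoc] at h2
    have hd' : HasDerivAt (fun x : ℝ => (NormedSpace.exp ((x - t k) • B k) * Y) i j)
        ((B k * (NormedSpace.exp ((s - t k) • B k) * Y)) i j) s := by
      have h1 := hasDerivAt_pi.1 hd i
      exact hasDerivAt_pi.1 h1 j
    have hs' : s ∈ Ico s (t (k + 1)) := ⟨le_rfl, hk2⟩
    show HasDerivWithinAt (fun x => partialFlow t B (N x) x i j)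
      ((A s * partialFlow t B (N s) s) i j) (Ici s) s
    rw [hform s hs', hB k s ⟨hk1, hk2⟩]
    refine hd'.hasDerivWithinAt.congr_of_eventuallyEq ?_ (by rw [hform s hs'])
    filter_upwards [Ico_mem_nhdsGE hk2] with x hx
    rw [hform x hx]

theorem IsStateTransition.unique {n : ℕ} {A : ℝ → Matrix (Fin n) (Fin n) ℝ} {t₀ : ℝ}
    (hA : (A '' Ici t₀).Finite) {Φ Ψ : ℝ → Matrix (Fin n) (Fin n) ℝ}
    (hΦ : IsStateTransition A t₀ Φ) (hΨ : IsStateTransition A t₀ Ψ) :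
    EqOn Φ Ψ (Ici t₀) := by
  obtain ⟨K, hK⟩ := hA.isBounded.exists_norm_le
  have hcont : ∀ F, IsStateTransition A t₀ F → ContinuousOn F (Ici t₀) := fun F hF =>
    continuousOn_pi.2 fun i => continuousOn_pi.2 fun j => hF.2.1 i j
  have hder : ∀ F, IsStateTransition A t₀ F → ∀ t, t₀ ≤ t →
      HasDerivWithinAt F (A t * F t) (Ici t) t := fun F hF t ht =>
    hasDerivWithinAt_pi.2 fun i => hasDerivWithinAt_pi.2 fun j => hF.2.2 t ht i j
  intro b hb
  refine ODE_solution_unique_of_mem_Icc_right (v := fun t X => A t * X) (s := fun _ => univ)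
    (K := K.toNNReal) (a := t₀) (b := b) ?_
    ((hcont Φ hΦ).mono Icc_subset_Ici_self) (fun t ht => hder Φ hΦ t ht.1) (fun _ _ => mem_univ _)
    ((hcont Ψ hΨ).mono Icc_subset_Ici_self) (fun t ht => hder Ψ hΨ t ht.1) (fun _ _ => mem_univ _)
    (hΦ.1.trans hΨ.1.symm) ⟨hb, le_rfl⟩
  intro t ht
  refine LipschitzOnWith.of_dist_le_mul fun X _ Y _ => ?_
  rw [dist_eq_norm, dist_eq_norm, ← mul_sub]
  refine (norm_mul_le _ _).trans ?_
  gcongr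
  exact (hK _ ⟨t, ht.1, rfl⟩).trans (Real.le_coe_toNNReal K)

end Existence

/-- For a coefficient that depends on the switching signed digraph only, the state transition
matrix is the solution of its defining initial value problem. -/
theorem IsSwitching.isStateTransition {n M : ℕ} {Gσ : Fin M → SignedDigraph n}
    {G : ℝ → SignedDigraph n} {t₀ : ℝ} (h : IsSwitching Gσ G t₀)
    (f : SignedDigraph n → Matrix (Fin n) (Fin n) ℝ) :
    IsStateTransition (fun t => f (G t)) t₀ (fun t => stateTransition (fun s => f (G s)) t t₀) := by
  obtain ⟨τ, hτ, t, ht0, ht, Gk, -, hG⟩ := h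
  exact Classical.epsilon_spec (exists_isStateTransition hτ ht0 ht (B := fun k => f (Gk k))
    fun k s hs => congrArg f (hG k s hs))

/-- The state transition matrix is determined on `[t₀, ∞)` by its initial value problem. -/
theorem IsSwitching.stateTransition_eq {n M : ℕ} {Gσ : Fin M → SignedDigraph n}
    {G : ℝ → SignedDigraph n} {t₀ : ℝ} (h : IsSwitching Gσ G t₀)
    (f : SignedDigraph n → Matrix (Fin n) (Fin n) ℝ) {Φ : ℝ → Matrix (Fin n) (Fin n) ℝ}
    (hΦ : IsStateTransition (fun t => f (G t)) t₀ Φ) {t : ℝ} (ht : t₀ ≤ t) :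
    stateTransition (fun s => f (G s)) t t₀ = Φ t := by
  refine (h.isStateTransition f).unique ?_ hΦ ht
  obtain ⟨τ, hτ, u, hu0, hu, Gk, hGk, hG⟩ := h
  refine (finite_range fun p => f (Gσ p)).subset ?_
  rintro _ ⟨s, hs, rfl⟩
  have hgrow : ∀ k : ℕ, t₀ + k * τ ≤ u k := by
    intro k
    induction k with
    | zero => simp [hu0]
    | succ k ih => push_cast; linarith [hu k]
  have hex : ∃ m, s < u m := by
    obtain ⟨k, hk⟩ := exists_nat_gt ((s - t₀) / τ)
    refine ⟨k, lt_of_lt_of_le ?_ (hgrow k)⟩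
    rw [div_lt_iff₀ hτ] at hk
    linarith
  classical
  have h0 : Nat.find hex ≠ 0 := by
    intro h
    have h1 := Nat.find_spec hex
    rw [h, hu0] at h1
    exact absurd h1 (not_lt.2 hs)
  obtain ⟨k, hk⟩ := Nat.exists_eq_succ_of_ne_zero h0
  have h1 := Nat.find_spec hex
  rw [hk] at h1
  obtain ⟨p, hp⟩ := hGk k
  refine ⟨p, ?_⟩
  show f (Gσ p) = f (G s)
  rw [hG k s ⟨not_lt.mp (Nat.find_min hex (by omega)), h1⟩, hp]

end OpinionDynamics

/-! Each column of the transition matrix for the absolute weights solves x_i' = ∑_k a_ik (x_k - x_i)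
with a_ik ≥ 0. This flow preserves nonnegativity and commutes with x ↦ x - c and x ↦ c - x, so it
keeps every box [lo, hi]^n invariant.

The box also shrinks. If d bounds the row sums, a nonnegative coordinate decays no faster than
e^{-dt}, and an edge active for a fixed time passes a fixed fraction of its source on to its target.
Dwell time and recurrence activate every edge of the union in each window of fixed length; chaining
such windows along paths gives P and δ > 0 with x_i(a + P) ≥ δ x_j(a) for all i, j
(`exists_influences`). Applied to x - lo and hi - x with one common source node, this contracts hi -
lo by the factor 1 - δ per period P (`exists_abs_sub_le`), so column j tends exponentially to a
constant ν_j. Positivity and unit row sums pass to ν.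

For the signed system, D Φ D solves the signed initial value problem (`IsStateTransition.gauge`),
hence is its transition matrix by uniqueness; the signs do not change absolute errors. -/

namespace OpinionDynamics

/-! ### Positivity and lower bounds for consensus trajectories. -/

section Consensus

variable {ι : Type*} [Fintype ι]

/-- `x` solves the consensus dynamics `x_i' = ∑_k a_ik(t) (x_k - x_i)` on `[t₀, ∞)`. -/
def IsConsensusTrajectory (A : ℝ → Matrix ι ι ℝ) (t₀ : ℝ) (x : ℝ → ι → ℝ) : Prop :=
  (∀ i, ContinuousOn (fun s => x s i) (Ici t₀)) ∧
    ∀ t, t₀ ≤ t → ∀ i,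
      HasDerivWithinAt (fun s => x s i) (∑ k, A t i k * (x t k - x t i)) (Ici t) t

namespace IsConsensusTrajectory

variable {A : ℝ → Matrix ι ι ℝ} {t₀ : ℝ} {x : ℝ → ι → ℝ}

theorem sub_const (hx : IsConsensusTrajectory A t₀ x) (c : ℝ) :
    IsConsensusTrajectory A t₀ (fun t i => x t i - c) := by
  refine ⟨fun i => (hx.1 i).sub continuousOn_const, fun t ht i => ?_⟩
  simpa using (hx.2 t ht i).sub_const c

theorem const_sub (hx : IsConsensusTrajectory A t₀ x) (c : ℝ) :
    IsConsensusTrajectory A t₀ (fun t i => c - x t i) := by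
  refine ⟨fun i => continuousOn_const.sub (hx.1 i), fun t ht i => ?_⟩
  refine ((hx.2 t ht i).const_sub c).congr_deriv ?_
  rw [← Finset.sum_neg_distrib]
  exact Finset.sum_congr rfl fun k _ => by ring

/-- The consensus dynamics with nonnegative weights preserve nonnegativity. -/
theorem nonneg (hA : ∀ t, t₀ ≤ t → ∀ i k, 0 ≤ A t i k) (hx : IsConsensusTrajectory A t₀ x)
    {a : ℝ} (ha : t₀ ≤ a) (h0 : ∀ i, 0 ≤ x a i) {b : ℝ} (hab : a ≤ b) (i : ι) : 0 ≤ x b i := by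
  -- Adding ε (s - a) makes the derivative strictly positive wherever a coordinate reaches the
  -- boundary; ε → 0 at the end.
  have key : ∀ ε : ℝ, 0 < ε → ∀ j, 0 ≤ x b j + ε * (b - a) := by
    intro ε hε
    have hc : ∀ j, ContinuousOn (fun s => x s j + ε * (s - a)) (Ici t₀) := fun j =>
      (hx.1 j).add (Continuous.continuousOn (by fun_prop))
    have hd : ∀ t, t₀ ≤ t → ∀ j, HasDerivWithinAt (fun s => x s j + ε * (s - a))
        ((∑ k, A t j k * (x t k - x t j)) + ε) (Ici t) t := by
      intro t ht j
      have h1 : HasDerivWithinAt (fun s : ℝ => ε * (s - a)) (ε * 1) (Ici t) t :=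
        (((hasDerivAt_id t).sub_const a).const_mul ε).hasDerivWithinAt
      exact ((hx.2 t ht j).add h1).congr_deriv (by rw [mul_one])
    -- Continuous induction on a closed set. A coordinate that vanishes at t is minimal there, so
    -- its perturbed right derivative is at least ε and it is nonnegative just after t.
    have hsub : Icc a b ⊆ {s | ∀ j, 0 ≤ x s j + ε * (s - a)} := by
      refine IsClosed.Icc_subset_of_forall_mem_nhdsWithin ?_ (by simpa using h0) ?_
      · have : {s | ∀ j, 0 ≤ x s j + ε * (s - a)} ∩ Icc a b =
            Icc a b ∩ ⋂ j, Icc a b ∩ (fun s => x s j + ε * (s - a)) ⁻¹' Ici 0 := by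
          ext s
          simp only [mem_inter_iff, mem_ofPred_eq, mem_iInter, mem_preimage, mem_Ici]
          exact ⟨fun h => ⟨h.2, fun j => ⟨h.2, h.1 j⟩⟩, fun h => ⟨fun j => (h.2 j).2, h.1⟩⟩
        rw [this]
        refine isClosed_Icc.inter (isClosed_iInter fun j => ?_)
        exact ((hc j).mono fun s hs => ha.trans hs.1).preimage_isClosed_of_isClosed
          isClosed_Icc isClosed_Ici
      · rintro t ⟨ht, htab⟩
        have ht0 : t₀ ≤ t := ha.trans htab.1
        refine (eventually_all (l := 𝓝[>] t)).2 fun j => ?_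
        rcases (ht j).lt_or_eq with hpos | hzero
        · have h1 : ContinuousWithinAt (fun s => x s j + ε * (s - a)) (Ioi t) t :=
            (hc j t ht0).mono fun s hs => ht0.trans (le_of_lt hs)
          filter_upwards [h1.eventually (lt_mem_nhds hpos)] with s hs using hs.le
        · have hder : 0 < (∑ k, A t j k * (x t k - x t j)) + ε := by
            refine add_pos_of_nonneg_of_pos (Finset.sum_nonneg fun k _ => ?_) hε
            refine mul_nonneg (hA t ht0 j k) ?_
            have : 0 ≤ x t k + ε * (t - a) := ht k
            linarith
          have h1 := (hasDerivWithinAt_iff_tendsto_slope' (s := Ioi t) (by simp)).1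
            ((hd t ht0 j).mono Ioi_subset_Ici_self)
          filter_upwards [h1.eventually (lt_mem_nhds hder), self_mem_nhdsWithin] with s hs hst
          rw [slope_def_field, ← hzero, sub_zero] at hs
          exact ((div_pos_iff_of_pos_right (sub_pos.2 hst)).1 hs).le
    exact hsub ⟨hab, le_rfl⟩
  refine le_of_forall_pos_le_add fun ε hε => ?_
  have hpos : 0 < b - a + 1 := by linarith
  -- The summand 1 keeps the denominator positive when a = b.
  have h1 := key (ε / (b - a + 1)) (by positivity) i
  have h2 : ε / (b - a + 1) * (b - a) ≤ ε := by
    rw [div_mul_eq_mul_div, div_le_iff₀ hpos]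
    nlinarith
  linarith

variable {d : ℝ}

/-- Affine lower bound for `e^{d (s - a)} x_i(s)`, where the edge from `k` to `i` has weight at
least `α` on `[a, b)`. -/
theorem linear_le_exp_mul (hx : IsConsensusTrajectory A t₀ x)
    (hA : ∀ t, t₀ ≤ t → ∀ i k, 0 ≤ A t i k) (hd : ∀ t, t₀ ≤ t → ∀ i, ∑ k, A t i k ≤ d)
    {a b c : ℝ} (ha : t₀ ≤ a) (h0 : ∀ t, a ≤ t → ∀ i, 0 ≤ x t i) (hab : a ≤ b) {i k : ι}
    (hc : ∀ s ∈ Ico a b, c ≤ Real.exp (d * (s - a)) * (A s i k * x s k)) :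
    x a i + c * (b - a) ≤ Real.exp (d * (b - a)) * x b i := by
  have hE : ∀ s : ℝ, HasDerivAt (fun s => Real.exp (d * (s - a)))
      (Real.exp (d * (s - a)) * d) s := fun s => by
    simpa using (((hasDerivAt_id s).sub_const a).const_mul d).exp
  -- Compare right derivatives: the integrating factor contributes d x_i, which outweighs the loss
  -- (∑_l a_il) x_i, and of the remaining gain ∑_l a_il x_l only the term l = k is kept.
  refine image_le_of_deriv_right_le_deriv_boundary (a := a) (b := b)
    (f := fun s => x a i + c * (s - a)) (f' := fun _ => c)
    (B := fun s => Real.exp (d * (s - a)) * x s i)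
    (B' := fun s => Real.exp (d * (s - a)) * d * x s i +
      Real.exp (d * (s - a)) * ∑ k, A s i k * (x s k - x s i))
    (Continuous.continuousOn (by fun_prop)) ?_ (by simp) ?_ ?_ ?_ ⟨hab, le_rfl⟩
  · intro s _
    have := (((hasDerivAt_id s).sub_const a).const_mul c).const_add (x a i)
    simpa using this.hasDerivWithinAt
  · exact (Continuous.continuousOn (by fun_prop)).mul
      ((hx.1 i).mono fun s hs => ha.trans hs.1)
  · intro s hs
    exact (hE s).hasDerivWithinAt.mul (hx.2 s (ha.trans hs.1) i)
  · intro s hs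
    refine (hc s hs).trans ?_
    rw [mul_assoc, ← mul_add]
    refine mul_le_mul_of_nonneg_left ?_ (Real.exp_pos _).le
    have hs0 := ha.trans hs.1
    have h1 : ∑ l, A s i l * (x s l - x s i) = ∑ l, A s i l * x s l - (∑ l, A s i l) * x s i := by
      rw [Finset.sum_mul, ← Finset.sum_sub_distrib]
      exact Finset.sum_congr rfl fun l _ => by ring
    have h2 : A s i k * x s k ≤ ∑ l, A s i l * x s l :=
      Finset.single_le_sum (f := fun l => A s i l * x s l)
        (fun l _ => mul_nonneg (hA s hs0 i l) (h0 s hs.1 l)) (Finset.mem_univ k)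
    have h3 := mul_le_mul_of_nonneg_right (hd s hs0 i) (h0 s hs.1 i)
    rw [h1]
    linarith

/-- With all input discarded (c = 0), what remains is decay at rate at most d. -/
theorem exp_neg_mul_le (hx : IsConsensusTrajectory A t₀ x)
    (hA : ∀ t, t₀ ≤ t → ∀ i k, 0 ≤ A t i k) (hd : ∀ t, t₀ ≤ t → ∀ i, ∑ k, A t i k ≤ d)
    {a b : ℝ} (ha : t₀ ≤ a) (h0 : ∀ t, a ≤ t → ∀ i, 0 ≤ x t i) (hab : a ≤ b) (i : ι) :
    Real.exp (-(d * (b - a))) * x a i ≤ x b i := by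
  have h := hx.linear_le_exp_mul hA hd ha h0 hab (i := i) (k := i) (c := 0) fun s hs =>
    mul_nonneg (Real.exp_pos _).le (mul_nonneg (hA s (ha.trans hs.1) i i) (h0 s hs.1 i))
  rw [Real.exp_neg, inv_mul_le_iff₀ (Real.exp_pos _)]
  simpa using h

/-- The source satisfies e^{d(s-a)} x_k(s) ≥ x_k(a), so the integrating factor turns the edge's
input into a constant rate α x_k(a). -/
theorem exp_neg_mul_edge_le (hx : IsConsensusTrajectory A t₀ x)
    (hA : ∀ t, t₀ ≤ t → ∀ i k, 0 ≤ A t i k) (hd : ∀ t, t₀ ≤ t → ∀ i, ∑ k, A t i k ≤ d)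
    {a b α : ℝ} (ha : t₀ ≤ a) (h0 : ∀ t, a ≤ t → ∀ i, 0 ≤ x t i) (hab : a ≤ b) {i k : ι}
    (hα : ∀ s ∈ Ico a b, A s i k = α) :
    Real.exp (-(d * (b - a))) * (α * (b - a) * x a k) ≤ x b i := by
  have h := hx.linear_le_exp_mul hA hd ha h0 hab (i := i) (k := k) (c := α * x a k) fun s hs => by
    have h1 := hx.exp_neg_mul_le hA hd ha h0 hs.1 k
    rw [Real.exp_neg, inv_mul_le_iff₀ (Real.exp_pos _)] at h1
    have h2 := mul_le_mul_of_nonneg_left h1 (hA s (ha.trans hs.1) i k)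
    rw [hα s hs] at h2 ⊢
    linarith
  rw [Real.exp_neg, inv_mul_le_iff₀ (Real.exp_pos _)]
  linarith [h0 a le_rfl i]

end IsConsensusTrajectory

/-! ### Propagation of influence along edges and paths. -/

/-- Along every nonnegative trajectory, a fixed positive fraction of the value at `j` is passed on
to `i` within the time `P`. -/
def Influences (A : ℝ → Matrix ι ι ℝ) (t₀ P δ : ℝ) (j i : ι) : Prop :=
  ∀ x, IsConsensusTrajectory A t₀ x → ∀ a, t₀ ≤ a → (∀ i, 0 ≤ x a i) → δ * x a j ≤ x (a + P) i

variable {A : ℝ → Matrix ι ι ℝ} {t₀ d P Q δ ε : ℝ} {i j k : ι}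

theorem Influences.mono (hδ : δ ≤ ε) (h : Influences A t₀ P ε j i) : Influences A t₀ P δ j i :=
  fun x hx a ha h0 => (mul_le_mul_of_nonneg_right hδ (h0 j)).trans (h x hx a ha h0)

theorem Influences.trans (hA : ∀ t, t₀ ≤ t → ∀ i k, 0 ≤ A t i k) (hP : 0 ≤ P) (hε : 0 ≤ ε)
    (h : Influences A t₀ P δ j k) (h' : Influences A t₀ Q ε k i) :
    Influences A t₀ (P + Q) (ε * δ) j i := by
  intro x hx a ha h0
  have hP' : a ≤ a + P := by linarith
  have h1 := h' x hx (a + P) (ha.trans hP') fun i => hx.nonneg hA ha h0 hP' i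
  rw [mul_assoc, ← add_assoc]
  exact (mul_le_mul_of_nonneg_left (h x hx a ha h0) hε).trans h1

theorem influences_self (hA : ∀ t, t₀ ≤ t → ∀ i k, 0 ≤ A t i k)
    (hd : ∀ t, t₀ ≤ t → ∀ i, ∑ k, A t i k ≤ d) (hP : 0 ≤ P) (i : ι) :
    Influences A t₀ P (Real.exp (-(d * P))) i i := by
  intro x hx a ha h0
  have := hx.exp_neg_mul_le hA hd ha (fun t ht => hx.nonneg hA ha h0 ht)
    (b := a + P) (by linarith) i
  simpa using this

/-- Paths of different lengths need different times and constants. Waiting at the target for the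
surplus time Q - P costs only a factor e^{-d(Q-P)}, so any later time works with all small ε, and
the filter form lets finitely many pairs share one P and one δ. -/
theorem Influences.eventually (hA : ∀ t, t₀ ≤ t → ∀ i k, 0 ≤ A t i k)
    (hd : ∀ t, t₀ ≤ t → ∀ i, ∑ k, A t i k ≤ d) (hP : 0 ≤ P) (hδ : 0 < δ)
    (h : Influences A t₀ P δ j i) :
    ∀ᶠ Q in atTop, ∀ᶠ ε in 𝓝[>] 0, Influences A t₀ Q ε j i := by
  filter_upwards [eventually_ge_atTop P] with Q hQ
  have h1 := h.trans hA hP (Real.exp_pos _).le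
    (influences_self hA hd (sub_nonneg.2 hQ) i)
  rw [add_sub_cancel] at h1
  filter_upwards [Ioc_mem_nhdsGT (mul_pos (Real.exp_pos (-(d * (Q - P)))) hδ)] with ε hε
  exact h1.mono hε.2

/-- If each edge of a strongly connected edge set is active with a fixed weight for a time `h`
during each time window of length `W`, then all nodes influence one another. -/
theorem exists_influences (hA : ∀ t, t₀ ≤ t → ∀ i k, 0 ≤ A t i k)
    (hd : ∀ t, t₀ ≤ t → ∀ i, ∑ k, A t i k ≤ d) {E : ι → ι → Prop} {h W : ℝ} (hh : 0 < h)
    (hW : 0 ≤ W)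
    (hE : ∀ j i, E j i → ∃ α, 0 < α ∧ ∀ a, t₀ ≤ a → ∃ s, a ≤ s ∧ s + h ≤ a + W ∧
      ∀ u ∈ Ico s (s + h), A u i j = α)
    (hconn : ∀ j i, j ≠ i → Relation.TransGen E j i) :
    ∃ P, 0 < P ∧ ∃ δ, 0 < δ ∧ ∀ j i, Influences A t₀ P δ j i := by
  have hedge : ∀ j i, E j i → ∃ δ, 0 < δ ∧ Influences A t₀ W δ j i := by
    intro j i hji
    obtain ⟨α, hα, hact⟩ := hE j i hji
    -- Hold at j until s, transfer during [s, s + h], hold at i until a + W: the three decay factors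
    -- multiply to e^{-dW}.
    refine ⟨Real.exp (-(d * W)) * (α * h), by positivity, fun x hx a ha h0 => ?_⟩
    obtain ⟨s, has, hsW, hs⟩ := hact a ha
    have hnn : ∀ t, a ≤ t → ∀ i, 0 ≤ x t i := fun t ht => hx.nonneg hA ha h0 ht
    have h1 := hx.exp_neg_mul_le hA hd ha hnn has j
    have h2 := hx.exp_neg_mul_edge_le hA hd (ha.trans has) (fun t ht => hnn t (has.trans ht))
      (by linarith) hs
    have h3 := hx.exp_neg_mul_le hA hd (a := s + h) (by linarith)
      (fun t ht => hnn t (by linarith)) hsW i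
    rw [add_sub_cancel_left] at h2
    refine le_trans ?_ ((mul_le_mul_of_nonneg_left ((mul_le_mul_of_nonneg_left
      (mul_le_mul_of_nonneg_left h1 (by positivity)) (Real.exp_pos _).le).trans h2)
      (Real.exp_pos _).le).trans h3)
    have h4 : Real.exp (-(d * W)) = Real.exp (-(d * (a + W - (s + h)))) *
        (Real.exp (-(d * h)) * Real.exp (-(d * (s - a)))) := by
      rw [← Real.exp_add, ← Real.exp_add]
      congr 1
      ring
    rw [h4]
    exact le_of_eq (by ring)
  have hpath : ∀ j i, Relation.TransGen E j i →
      ∃ P, 0 ≤ P ∧ ∃ δ, 0 < δ ∧ Influences A t₀ P δ j i := by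
    intro j i hji
    induction hji with
    | single hji =>
      obtain ⟨δ, hδ, hinf⟩ := hedge _ _ hji
      exact ⟨W, hW, δ, hδ, hinf⟩
    | tail _ hki ih =>
      obtain ⟨P, hP, δ, hδ, hinf⟩ := ih
      obtain ⟨ε, hε, hinf'⟩ := hedge _ _ hki
      exact ⟨P + W, by positivity, ε * δ, by positivity, hinf.trans hA hP hε.le hinf'⟩
  have hall : ∀ j i, ∀ᶠ P in atTop, ∀ᶠ δ in 𝓝[>] 0, Influences A t₀ P δ j i := by
    intro j i
    obtain ⟨P, hP, δ, hδ, hinf⟩ : ∃ P, 0 ≤ P ∧ ∃ δ, 0 < δ ∧ Influences A t₀ P δ j i := by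
      rcases eq_or_ne j i with rfl | hne
      · exact ⟨0, le_rfl, _, Real.exp_pos _, influences_self hA hd le_rfl j⟩
      · exact hpath j i (hconn j i hne)
    exact hinf.eventually hA hd hP hδ
  obtain ⟨P, hPinf, hP⟩ := ((eventually_all.2 fun j => eventually_all.2 (hall j)).and
    (eventually_gt_atTop 0)).exists
  obtain ⟨δ, hinf, hδ⟩ := ((eventually_all.2 fun j => eventually_all.2 (hPinf j)).and
    self_mem_nhdsWithin).exists
  exact ⟨P, hP, δ, hδ, hinf⟩

/-! ### Contraction and convergence to agreement. -/

/-- Mutual influence within a fixed time forces exponential agreement, uniformly over the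
trajectories with initial values in `[0, 1]`. -/
theorem exists_abs_sub_le [Nonempty ι] (hA : ∀ t, t₀ ≤ t → ∀ i k, 0 ≤ A t i k)
    (hP : 0 < P) (hδ : 0 < δ) (hinf : ∀ j i, Influences A t₀ P δ j i) :
    ∃ C, 0 < C ∧ ∃ r, 0 < r ∧ ∀ x, IsConsensusTrajectory A t₀ x → (∀ i, x t₀ i ∈ Icc 0 1) →
      ∀ t, t₀ ≤ t → ∀ s, t ≤ s → ∀ i j, |x t i - x s j| ≤ C * Real.exp (-r * (t - t₀)) := by
  obtain ⟨j₀⟩ := ‹Nonempty ι›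
  -- δ ≥ 1 is not excluded; the maximum keeps q positive, so that its logarithm gives a rate.
  set q : ℝ := max (1 - δ) (1 / 2) with hq
  have hq0 : 0 < q := lt_max_of_lt_right (by norm_num)
  have hq1 : q < 1 := max_lt (by linarith) (by norm_num)
  have hlog : Real.log q < 0 := Real.log_neg hq0 hq1
  -- The factor q⁻¹ pays for the incomplete last period: q^⌊u⌋ ≤ q^(u-1).
  refine ⟨q⁻¹, by positivity, -Real.log q / P, div_pos (by linarith) hP, ?_⟩
  intro x hx hx01
  have hstep : ∀ k : ℕ, ∃ lo hi, hi - lo ≤ q ^ k ∧ ∀ t, t₀ + k * P ≤ t → ∀ i,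
      x t i ∈ Icc lo hi := by
    have hbd : ∀ a, t₀ ≤ a → ∀ lo hi, (∀ i, x a i ∈ Icc lo hi) →
        ∀ t, a ≤ t → ∀ i, x t i ∈ Icc lo hi := fun a ha lo hi h t ht i =>
      ⟨sub_nonneg.1 ((hx.sub_const lo).nonneg hA ha (fun i => sub_nonneg.2 (h i).1) ht i),
        sub_nonneg.1 ((hx.const_sub hi).nonneg hA ha (fun i => sub_nonneg.2 (h i).2) ht i)⟩
    intro k
    induction k with
    | zero => exact ⟨0, 1, by simp, by simpa using hbd t₀ le_rfl 0 1 hx01⟩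
    | succ k ih =>
      obtain ⟨lo, hi, hlen, hmem⟩ := ih
      have ha : t₀ ≤ t₀ + k * P := by linarith [mul_nonneg (Nat.cast_nonneg (α := ℝ) k) hP.le]
      have hm := hmem _ le_rfl
      set a := t₀ + k * P
      have haP : t₀ + (k + 1 : ℕ) * P = a + P := by push_cast; ring
      rw [haP]
      -- Both ends are moved using the same node j₀, so its value cancels from the new width (1 -
      -- δ)(hi - lo).
      refine ⟨lo + δ * (x a j₀ - lo), hi - δ * (hi - x a j₀), ?_,
        hbd (a + P) (by linarith) _ _ fun i => ⟨?_, ?_⟩⟩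
      · have h1 : 0 ≤ hi - lo := by linarith [(hm j₀).1, (hm j₀).2]
        calc _ = (1 - δ) * (hi - lo) := by ring
          _ ≤ q * (hi - lo) := mul_le_mul_of_nonneg_right (le_max_left _ _) h1
          _ ≤ q * q ^ k := mul_le_mul_of_nonneg_left hlen hq0.le
          _ = q ^ (k + 1) := (pow_succ' q k).symm
      · have := hinf j₀ i _ (hx.sub_const lo) a ha fun i => sub_nonneg.2 (hm i).1
        linarith
      · have := hinf j₀ i _ (hx.const_sub hi) a ha fun i => sub_nonneg.2 (hm i).2
        linarith
  intro t ht s hts i j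
  have ht' : 0 ≤ (t - t₀) / P := div_nonneg (by linarith) hP.le
  obtain ⟨lo, hi, hlen, hmem⟩ := hstep ⌊(t - t₀) / P⌋₊
  have hfl : t₀ + ⌊(t - t₀) / P⌋₊ * P ≤ t := by
    have := (le_div_iff₀ hP).1 (Nat.floor_le ht')
    linarith
  have h1 := hmem t hfl i
  have h2 := hmem s (hfl.trans hts) j
  have h3 : |x t i - x s j| ≤ q ^ ⌊(t - t₀) / P⌋₊ :=
    (abs_sub_le_iff.2 ⟨by linarith [h1.2, h2.1], by linarith [h1.1, h2.2]⟩).trans hlen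
  refine h3.trans ?_
  have h4 : Real.exp (-(-Real.log q / P) * (t - t₀)) = q ^ ((t - t₀) / P) := by
    rw [Real.rpow_def_of_pos hq0]
    congr 1
    ring
  rw [h4, ← Real.rpow_natCast, ← Real.rpow_neg_one, ← Real.rpow_add hq0]
  exact Real.rpow_le_rpow_of_exponent_ge hq0 hq1.le
    (by linarith [Nat.lt_floor_add_one ((t - t₀) / P)])

end Consensus

/-- One coordinate sampled at t₀ + m is Cauchy. Since the bound compares different coordinates,
letting s → ∞ along the samples gives the same limit for all of them. -/
theorem exists_forall_abs_sub_le {ι : Type*} [Nonempty ι] {x : ℝ → ι → ℝ} {t₀ C r : ℝ}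
    (hr : 0 < r)
    (h : ∀ t, t₀ ≤ t → ∀ s, t ≤ s → ∀ i j, |x t i - x s j| ≤ C * Real.exp (-r * (t - t₀))) :
    ∃ c, ∀ t, t₀ ≤ t → ∀ i, |x t i - c| ≤ C * Real.exp (-r * (t - t₀)) := by
  obtain ⟨j⟩ := ‹Nonempty ι›
  have htop : Tendsto (fun m : ℕ => t₀ + (m : ℝ)) atTop atTop :=
    tendsto_atTop_add_const_left _ _ tendsto_natCast_atTop_atTop
  have hb : Tendsto (fun m : ℕ => C * Real.exp (-r * (m : ℝ))) atTop (𝓝 0) := by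
    have : Tendsto (fun m : ℕ => -r * (m : ℝ)) atTop atBot :=
      tendsto_natCast_atTop_atTop.const_mul_atTop_of_neg (neg_lt_zero.2 hr)
    simpa using (Real.tendsto_exp_atBot.comp this).const_mul C
  have hcau : CauchySeq fun m : ℕ => x (t₀ + m) j := by
    refine cauchySeq_of_le_tendsto_0' _ (fun m l hml => ?_) hb
    have := h (t₀ + m) (by simp) (t₀ + l) (by simpa using hml) j j
    rwa [add_sub_cancel_left] at this
  obtain ⟨c, hc⟩ := cauchySeq_tendsto_of_complete hcau
  refine ⟨c, fun t ht i => ?_⟩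
  refine le_of_tendsto (tendsto_const_nhds.sub hc).abs ?_
  filter_upwards [htop.eventually_ge_atTop t] with m hm using h t ht _ hm i j

theorem ConvergesExponentially.of_le {n : ℕ} {F : ℝ → Matrix (Fin n) (Fin n) ℝ} {t₀ C r : ℝ}
    {L : Matrix (Fin n) (Fin n) ℝ} (hC : 0 < C) (hr : 0 < r)
    (h : ∀ t, t₀ ≤ t → ∀ i j, |F t i j - L i j| ≤ C * Real.exp (-r * (t - t₀))) :
    ConvergesExponentially F t₀ L := by
  refine ⟨tendsto_pi_nhds.2 fun i => tendsto_pi_nhds.2 fun j => ?_, C, hC, r, hr, h⟩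
  have hb : Tendsto (fun t => C * Real.exp (-r * (t - t₀))) atTop (𝓝 0) := by
    have : Tendsto (fun t => -r * (t - t₀)) atTop atBot :=
      (tendsto_atTop_add_const_right _ (-t₀) tendsto_id).const_mul_atTop_of_neg (neg_lt_zero.2 hr)
    simpa using (Real.tendsto_exp_atBot.comp this).const_mul C
  refine tendsto_iff_norm_sub_tendsto_zero.2 (squeeze_zero' (.of_forall fun _ => norm_nonneg _) ?_ hb)
  filter_upwards [eventually_ge_atTop t₀] with t ht using h t ht i j

/-! ### Switching signed digraphs as consensus dynamics -/

theorem neg_nonnegLaplacian_mulVec {n : ℕ} (A : Matrix (Fin n) (Fin n) ℝ) (v : Fin n → ℝ)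
    (i : Fin n) : ∑ k, (-nonnegLaplacian A) i k * v k = ∑ k, A i k * (v k - v i) := by
  rw [← Finset.add_sum_erase _ _ (Finset.mem_univ i), ← Finset.add_sum_erase _
    (fun k => A i k * (v k - v i)) (Finset.mem_univ i)]
  have h : ∀ k ∈ Finset.univ.erase i, (-nonnegLaplacian A) i k * v k = A i k * v k := by
    intro k hk
    simp [nonnegLaplacian, Finset.ne_of_mem_erase hk]
  rw [Finset.sum_congr rfl h]
  simp only [Matrix.neg_apply, nonnegLaplacian, Matrix.of_apply, if_true, sub_self, mul_zero,
    mul_sub, Finset.sum_sub_distrib, neg_mul, Finset.sum_mul]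
  ring

/-- Non-edges and the diagonal carry weight zero, so summing over neighbors or over all k ≠ i is the
same. -/
theorem SignedDigraph.laplacian_apply {n : ℕ} (G : SignedDigraph n) (i j : Fin n) :
    G.laplacian i j = if j = i then ∑ k ∈ Finset.univ.erase i, |G.adj i k| else -G.adj i j := by
  classical
  have h : ∑ k ∈ Finset.univ.filter (fun k => (k, i) ∈ G.edges), |G.adj i k| =
      ∑ k ∈ Finset.univ.erase i, |G.adj i k| := by
    rw [Finset.sum_erase _ (by simp [G.adj_self]), Finset.sum_filter]
    refine Finset.sum_congr rfl fun k _ => ?_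
    split_ifs with hk
    · rfl
    · rw [not_not.1 (mt (G.adj_ne_zero_iff i k).1 hk), abs_zero]
  rw [← h]
  simp only [SignedDigraph.laplacian, Matrix.of_apply]

/-- A gauge transforms the Laplacian of a signed digraph into that of its absolute weights. -/
theorem SignedDigraph.laplacian_eq_of_gauge {n : ℕ} (G : SignedDigraph n) {e : Fin n → ℝ}
    (he : ∀ i, e i = 1 ∨ e i = -1)
    (h : Matrix.diagonal e * G.adj * Matrix.diagonal e = absMatrix G.adj) (i j : Fin n) :
    G.laplacian i j = e i * nonnegLaplacian (absMatrix G.adj) i j * e j := by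
  have hsq : ∀ i, e i * e i = 1 := fun i => by rcases he i with h | h <;> simp [h]
  rw [G.laplacian_apply]
  have hij := congrFun (congrFun h i) j
  simp only [Matrix.mul_diagonal, Matrix.diagonal_mul, absMatrix, Matrix.of_apply] at hij
  simp only [nonnegLaplacian, absMatrix, Matrix.of_apply]
  split_ifs with hji
  · subst hji
    linear_combination (-∑ k ∈ Finset.univ.erase j, |G.adj j k|) * hsq j
  · rw [← hij]
    linear_combination (G.adj i j * (e i * e i)) * hsq j + G.adj i j * hsq i

/-- Each instant lies in an interval of length at least `τ` on which the switching signed digraph is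
constant. -/
theorem IsSwitching.exists_Ico {n M : ℕ} {Gσ : Fin M → SignedDigraph n} {G : ℝ → SignedDigraph n}
    {t₀ : ℝ} (h : IsSwitching Gσ G t₀) :
    ∃ τ, 0 < τ ∧ ∀ s, t₀ ≤ s → (∃ p, G s = Gσ p) ∧
      ∃ a b, τ ≤ b - a ∧ s ∈ Ico a b ∧ ∀ u ∈ Ico a b, G u = G s := by
  obtain ⟨τ, hτ, t, ht0, ht, Gk, hGk, hG⟩ := h
  refine ⟨τ, hτ, fun s hs => ?_⟩
  have hgrow : ∀ k : ℕ, t₀ + k * τ ≤ t k := by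
    intro k
    induction k with
    | zero => simp [ht0]
    | succ k ih => push_cast; linarith [ht k]
  have htop : Tendsto t atTop atTop :=
    tendsto_atTop_mono hgrow (tendsto_atTop_add_const_left _ _
      (tendsto_natCast_atTop_atTop.atTop_mul_const hτ))
  obtain ⟨k, hk⟩ : ∃ k, s ∈ Ico (t k) (t (k + 1)) := by
    by_contra! hcon
    have hle : ∀ k, t k ≤ s := by
      intro k
      induction k with
      | zero => rwa [ht0]
      | succ k ih => exact not_lt.1 fun hlt => hcon k ⟨ih, hlt⟩
    obtain ⟨k, hk⟩ := (htop.eventually_gt_atTop s).exists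
    exact absurd (hle k) (not_le.2 hk)
  obtain ⟨p, hp⟩ := hGk k
  exact ⟨⟨p, (hG k s hk).trans hp⟩, t k, t (k + 1), ht k, hk,
    fun u hu => (hG k u hu).trans (hG k s hk).symm⟩

/-- Each member of a recurrent family is active for a fixed positive time during each time window of
a fixed length. -/
theorem IsRecurrent.exists_active {n M : ℕ} {Gσ : Fin M → SignedDigraph n}
    {G : ℝ → SignedDigraph n} {t₀ : ℝ} (hrec : IsRecurrent Gσ G t₀) (h : IsSwitching Gσ G t₀) :
    ∃ l, 0 < l ∧ ∃ W, 0 ≤ W ∧ ∀ p, ∀ a, t₀ ≤ a → ∃ s, a ≤ s ∧ s + l ≤ a + W ∧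
      ∀ u ∈ Ico s (s + l), G u = Gσ p := by
  obtain ⟨T, hT, hrec⟩ := hrec
  obtain ⟨τ, hτ, hG⟩ := h.exists_Ico
  refine ⟨τ / 2, by positivity, T + 2 * τ, by positivity, fun p a ha => ?_⟩
  -- Starting at a + τ leaves room to go back: s lies in a constancy interval of length at least τ,
  -- which extends by τ / 2 either after s or before it.
  obtain ⟨s, hs, hsp⟩ := hrec p (a + τ) (by linarith)
  obtain ⟨-, b, c, hbc, hsb, hconst⟩ := hG s (by linarith [hs.1])
  rcases le_total (τ / 2) (c - s) with hc | hc
  · exact ⟨s, by linarith [hs.1], by linarith [hs.2], fun u hu =>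
      (hconst u ⟨hsb.1.trans hu.1, by linarith [hu.2]⟩).trans hsp⟩
  · exact ⟨s - τ / 2, by linarith [hs.1], by linarith [hs.2], fun u hu =>
      (hconst u ⟨by linarith [hu.1], by linarith [hu.2, hsb.2]⟩).trans hsp⟩

theorem IsStateTransition.isConsensusTrajectory {n : ℕ} {A Φ : ℝ → Matrix (Fin n) (Fin n) ℝ}
    {t₀ : ℝ} (hΦ : IsStateTransition (fun t => -nonnegLaplacian (A t)) t₀ Φ) (j : Fin n) :
    IsConsensusTrajectory A t₀ (fun t i => Φ t i j) := by
  refine ⟨fun i => hΦ.2.1 i j, fun t ht i => (hΦ.2.2 t ht i j).congr_deriv ?_⟩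
  rw [Matrix.mul_apply, neg_nonnegLaplacian_mulVec]

/-- The state transition matrix of the consensus dynamics has unit row sums. -/
theorem IsStateTransition.sum_eq_one {n : ℕ} {A Φ : ℝ → Matrix (Fin n) (Fin n) ℝ} {t₀ : ℝ}
    (hA : ∀ t, t₀ ≤ t → ∀ i k, 0 ≤ A t i k)
    (hΦ : IsStateTransition (fun t => -nonnegLaplacian (A t)) t₀ Φ) {t : ℝ} (ht : t₀ ≤ t)
    (i : Fin n) : ∑ j, Φ t i j = 1 := by
  have hx : IsConsensusTrajectory A t₀ (fun t i => ∑ j, Φ t i j) := by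
    refine ⟨fun i => continuousOn_finsetSum _ fun j _ => hΦ.2.1 i j, fun t ht i => ?_⟩
    refine (HasDerivWithinAt.fun_sum fun j _ =>
      (hΦ.isConsensusTrajectory j).2 t ht i).congr_deriv ?_
    rw [Finset.sum_comm]
    refine Finset.sum_congr rfl fun k _ => ?_
    rw [← Finset.mul_sum, Finset.sum_sub_distrib]
  have h0 : ∀ i, ∑ j, Φ t₀ i j = 1 := fun i => by simp [hΦ.1, Matrix.one_apply]
  -- The row sums form a trajectory starting at the constant 1; positivity from both sides pins it
  -- there.
  have h1 := (hx.sub_const 1).nonneg hA le_rfl (fun i => by simp [h0]) ht i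
  have h2 := (hx.const_sub 1).nonneg hA le_rfl (fun i => by simp [h0]) ht i
  linarith

/-- A gauge transforms the state transition matrix of the signed consensus dynamics into that of the
dynamics with absolute weights. -/
theorem IsStateTransition.gauge {n : ℕ} {G : ℝ → SignedDigraph n} {t₀ : ℝ}
    {Φ : ℝ → Matrix (Fin n) (Fin n) ℝ} {D : Matrix (Fin n) (Fin n) ℝ} (hD : IsGauge G t₀ D)
    (hΦ : IsStateTransition (fun t => -nonnegLaplacian (absMatrix (G t).adj)) t₀ Φ) :
    IsStateTransition (fun t => -(G t).laplacian) t₀ (fun t => D * Φ t * D) := by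
  obtain ⟨⟨e, he, rfl⟩, hG⟩ := hD
  have hsq : ∀ i, e i * e i = 1 := fun i => by rcases he i with h | h <;> simp [h]
  have happ : ∀ (X : Matrix (Fin n) (Fin n) ℝ) i j,
      (Matrix.diagonal e * X * Matrix.diagonal e) i j = e i * X i j * e j := fun X i j => by
    simp only [Matrix.mul_diagonal, Matrix.diagonal_mul]
  refine ⟨?_, fun i j => ?_, fun t ht i j => ?_⟩
  · ext i j
    refine (happ (Φ t₀) i j).trans ?_
    rw [hΦ.1]
    rcases eq_or_ne i j with rfl | hij
    · simp [hsq]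
    · simp [hij]
  · simp only [happ]
    exact (continuousOn_const.mul (hΦ.2.1 i j)).mul continuousOn_const
  · simp only [happ]
    refine (((hΦ.2.2 t ht i j).const_mul (e i)).mul_const (e j)).congr_deriv ?_
    simp only [Matrix.mul_apply (M := -_), happ, Matrix.neg_apply, Finset.mul_sum, Finset.sum_mul]
    refine Finset.sum_congr rfl fun k _ => ?_
    rw [(G t).laplacian_eq_of_gauge he (hG t ht)]
    linear_combination (e i * nonnegLaplacian (absMatrix (G t).adj) i k * Φ t k j * e j) * hsq k

/-- Under recurrent switching with strongly connected union, all nodes influence one another in the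
dynamics with absolute weights. -/
theorem IsSwitching.exists_influences_absMatrix {n M : ℕ} {Gσ : Fin M → SignedDigraph n} {G : ℝ → SignedDigraph n}
    {t₀ : ℝ} (hswitch : IsSwitching Gσ G t₀) (hrec : IsRecurrent Gσ G t₀)
    (hconn : StronglyConnected (unionEdges Gσ)) :
    ∃ P, 0 < P ∧ ∃ δ, 0 < δ ∧ ∀ j i, Influences (fun t => absMatrix (G t).adj) t₀ P δ j i := by
  -- The family is finite, so one d bounds all row sums.
  obtain ⟨d, hd⟩ : ∃ d, ∀ p i, ∑ k, absMatrix (Gσ p).adj i k ≤ d :=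
    (eventually_all.2 fun p => eventually_all.2 fun i => eventually_ge_atTop _).exists
  obtain ⟨l, hl, W, hW, hact⟩ := hrec.exists_active hswitch
  refine exists_influences (d := d) (fun t _ i k => abs_nonneg _) (fun t ht i => ?_)
    (E := fun j i => (j, i) ∈ unionEdges Gσ) hl hW (fun j i hji => ?_) hconn
  · obtain ⟨_, -, hG⟩ := hswitch.exists_Ico
    obtain ⟨p, hp⟩ := (hG t ht).1
    rw [hp]
    exact hd p i
  · obtain ⟨p, hp⟩ := mem_iUnion.1 hji
    refine ⟨|(Gσ p).adj i j|, abs_pos.2 (((Gσ p).adj_ne_zero_iff i j).2 hp), fun a ha => ?_⟩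
    obtain ⟨s, has, hsW, hs⟩ := hact p a ha
    exact ⟨s, has, hsW, fun u hu => by simp [absMatrix, hs u hu]⟩

end OpinionDynamics

/-! ### Assembly of the limit and transfer to the signed system. -/

open OpinionDynamics in
theorem theorem3 {n M : ℕ} (hn : 0 < n)
    (Gσ : Fin M → OpinionDynamics.SignedDigraph n) (G : ℝ → OpinionDynamics.SignedDigraph n)
    (t₀ : ℝ) (ht₀ : 0 ≤ t₀)
    (hswitch : OpinionDynamics.IsSwitching Gσ G t₀)
    (hrec : OpinionDynamics.IsRecurrent Gσ G t₀)
    (hconn : OpinionDynamics.StronglyConnected (OpinionDynamics.unionEdges Gσ))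
    (hbal : OpinionDynamics.IsSimultaneouslyBalanced G t₀) :
    ∃ ν : Fin n → ℝ, (∀ i, 0 ≤ ν i) ∧ ∑ i, ν i = 1 ∧
      OpinionDynamics.ConvergesExponentially
        (fun t => OpinionDynamics.stateTransition
          (fun s => -OpinionDynamics.nonnegLaplacian
            (OpinionDynamics.absMatrix (G s).adj)) t t₀)
        t₀ (Matrix.vecMulVec (fun _ => 1) ν) ∧
      ∀ D : Matrix (Fin n) (Fin n) ℝ, OpinionDynamics.IsGauge G t₀ D →
        OpinionDynamics.ConvergesExponentially
          (fun t => OpinionDynamics.stateTransition (fun s => -(G s).laplacian) t t₀)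
          t₀ (D * Matrix.vecMulVec (fun _ => 1) ν * D) := by
  have : Nonempty (Fin n) := ⟨⟨0, hn⟩⟩
  have hΦ := hswitch.isStateTransition fun g => -nonnegLaplacian (absMatrix g.adj)
  set Φ := fun t => stateTransition (fun s => -nonnegLaplacian (absMatrix (G s).adj)) t t₀
  have hA : ∀ t, t₀ ≤ t → ∀ i k, 0 ≤ absMatrix (G t).adj i k := fun t _ i k => abs_nonneg _
  obtain ⟨P, hP, δ, hδ, hinf⟩ := hswitch.exists_influences_absMatrix hrec hconn
  obtain ⟨C, hC, r, hr, hx⟩ := exists_abs_sub_le hA hP hδ hinf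
  have hcol := fun j => hΦ.isConsensusTrajectory (A := fun t => absMatrix (G t).adj) j
  have h0 : ∀ i j, Φ t₀ i j ∈ Icc 0 1 := fun i j => by
    rw [hΦ.1, Matrix.one_apply]
    split_ifs <;> simp
  -- All columns start in [0, 1], so the same C and r serve every j.
  choose ν hν using fun j => exists_forall_abs_sub_le hr (hx _ (hcol j) fun i => h0 i j)
  have hconv : ConvergesExponentially Φ t₀ (Matrix.vecMulVec (fun _ => 1) ν) :=
    .of_le hC hr fun t ht i j => by simpa [Matrix.vecMulVec_apply] using hν j t ht i
  have hlim : ∀ i j, Tendsto (fun t => Φ t i j) atTop (𝓝 (ν j)) := fun i j => by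
    simpa [Matrix.vecMulVec_apply] using tendsto_pi_nhds.1 (tendsto_pi_nhds.1 hconv.1 i) j
  refine ⟨ν, fun j => ?_, ?_, hconv, fun D hD => ?_⟩
  · refine ge_of_tendsto (hlim ⟨0, hn⟩ j) ?_
    filter_upwards [eventually_ge_atTop t₀] with t ht
    exact (hcol j).nonneg hA le_rfl (fun i => (h0 i j).1) ht _
  · refine tendsto_nhds_unique (tendsto_finsetSum _ fun j _ => hlim ⟨0, hn⟩ j) ?_
    refine tendsto_const_nhds.congr' ?_
    filter_upwards [eventually_ge_atTop t₀] with t ht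
    exact (hΦ.sum_eq_one (A := fun t => absMatrix (G t).adj) hA ht _).symm
  · refine .of_le hC hr fun t ht i j => ?_
    -- By uniqueness the signed transition matrix is D Φ D, and conjugation by signs leaves each
    -- entry's error unchanged in absolute value.
    rw [hswitch.stateTransition_eq (fun g => -g.laplacian) (hΦ.gauge hD) ht]
    obtain ⟨⟨e, he, rfl⟩, -⟩ := hD
    have habs : ∀ i, |e i| = 1 := fun i => by rcases he i with h | h <;> simp [h]
    simp only [Matrix.mul_diagonal, Matrix.diagonal_mul, Matrix.vecMulVec_apply, one_mul]
    rw [← sub_mul, ← mul_sub, abs_mul, abs_mul, habs, habs, one_mul, mul_one]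
    exact hν j t ht i
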